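/- Notation. For $m\in\mathbb N$, $z=(x,\xi)\in\mathbb R^{2m}$, $\tau\in\mathbb R$ and $g\in L^2(\mathbb R^m)$ (complex-valued) put $$\rho(z;\tau)g(y)=e^{2\pi i\tau}e^{-i\pi x\cdot\xi}e^{2\pi i\xi\cdot y}g(y-x).$$ Let $\mathrm{Sp}(m,\mathbb R)$ be the group of real symplectic $2m\times 2m$ matrices. A metaplectic operator with projection $S\in \mathrm{Sp}(m,\mathbb R)$ is a unitary operator $\hat S$ on $L^2(\mathbb R^m)$ with $\hat S\rho(z;\tau)\hat S^{-1}=\rho(Sz;\tau)$ for all $z\in\mathbb R^{2m}$, $\tau\in\mathbb R$; it is determined by $S$ up to a phase factor. For $\mathcal A\in \mathrm{Sp}(2n,\mathbb R)$, a metaplectic operator $\hat{\mathcal A}$ on $L^2(\mathbb R^{2n})$ with projection $\mathcal A$, and $f\in L^2(\mathbb R^n)$, the $\mathcal A$-Wigner distribution is $W_{\mathcal A}f=\hat{\mathcal A}(f\otimes\bar f)\in L^2(\mathbb R^{2n})$. For $s\ge 0$ let $v_s(X)=(1+|X|^2)^{s/2}$; a measurable $F:\mathbb R^{2n}\to\mathbb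 C$ belongs to $L^2_{v_s}(\mathbb R^{2n})$ if $\int_{\mathbb R^{2n}}|F(X)|^2v_s(X)^2\,dX<\infty$, and, for $\Gamma\subseteq\mathbb R^{2n}$, to $L^2_{v_s}(\Gamma)$ if $\chi_\Gamma F\in L^2_{v_s}(\mathbb R^{2n})$. The $\mathcal A$-Wigner wave front set of order $s$, $WF^s_{\mathcal A}(f)\subseteq\mathbb R^{2n}\setminus\{0\}$, is the set of all $X_0\neq 0$ for which there is no open set $\Gamma\subseteq\mathbb R^{2n}\setminus\{0\}$, invariant under multiplication by positive reals and containing $X_0$, with $W_{\mathcal A}f\in L^2_{v_s}(\Gamma)$. Proposition 4.5. Let $f\in L^2(\mathbb R^n)$, let $\mathcal A\in \mathrm{Sp}(2n,\mathbb R)$, let $\hat{\mathcal A}$ be a metaplectic operator with projection $\mathcal A$, and let $s\ge 0$. Then $$WF^s_{\mathcal A}(f)=\emptyset\iff W_{\mathcal A}f\in L^2_{v_s}(\mathbb R^{2n}).$$ -/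

import Mathlib

open MeasureTheory
open scoped ENNReal Matrix ComplexConjugate

noncomputable section

namespace AWigner

variable {ι : Type*} [Fintype ι]

/-- `L²(ℝ^ι)`: complex-valued, with respect to Lebesgue measure on Euclidean space. -/
abbrev L2 (ι : Type*) [Fintype ι] : Type _ :=
  Lp ℂ 2 (volume : Measure (EuclideanSpace ℝ ι))

/-- The first half `x` of `z = (x, ξ)`. -/
def fstHalf (z : EuclideanSpace ℝ (ι ⊕ ι)) : EuclideanSpace ℝ ι :=
  WithLp.toLp 2 fun i => z (Sum.inl i)

/-- The second half `ξ` of `z = (x, ξ)`. -/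
def sndHalf (z : EuclideanSpace ℝ (ι ⊕ ι)) : EuclideanSpace ℝ ι :=
  WithLp.toLp 2 fun i => z (Sum.inr i)

/-- Lebesgue measure on `ℝ^{2n}` is the product of the Lebesgue measures on the two halves. -/
theorem measurePreserving_halves :
    MeasurePreserving (fun z : EuclideanSpace ℝ (ι ⊕ ι) => (fstHalf z, sndHalf z))
      volume (volume.prod volume) := by
  have h1 := PiLp.volume_preserving_ofLp (ι ⊕ ι)
  have h2 := volume_measurePreserving_sumPiEquivProdPi (fun _ : ι ⊕ ι => ℝ)
  have h3 := (PiLp.volume_preserving_toLp ι).prod (PiLp.volume_preserving_toLp ι)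
  exact h3.comp (h2.comp h1)

/-- The pointwise function `(x, y) ↦ f x * conj (g y)` is square integrable. -/
theorem memLp_tensorConj (f g : L2 ι) :
    MemLp (fun z : EuclideanSpace ℝ (ι ⊕ ι) => f (fstHalf z) * conj (g (sndHalf z))) 2 volume := by
  have hf := Lp.memLp f
  have hg := (Lp.memLp g).star
  have hm : AEStronglyMeasurable
      (fun p : EuclideanSpace ℝ ι × EuclideanSpace ℝ ι => f p.1 * conj (g p.2))
      (volume.prod volume) := (hf.1.comp_fst).mul (hg.1.comp_snd)
  have h : MemLp (fun p : EuclideanSpace ℝ ι × EuclideanSpace ℝ ι => f p.1 * conj (g p.2)) 2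
      (volume.prod volume) := by
    rw [memLp_two_iff_integrable_sq_norm hm]
    have hi := (hf.integrable_norm_pow two_ne_zero).mul_prod (hg.integrable_norm_pow two_ne_zero)
    simpa [mul_pow] using hi
  exact h.comp_measurePreserving measurePreserving_halves

/-- The tensor product `f ⊗ ḡ ∈ L²(ℝ^{2n})`. -/
def tensorConj (f g : L2 ι) : L2 (ι ⊕ ι) :=
  (memLp_tensorConj f g).toLp _

/-- The pointwise formula of the Schrödinger representation of the Heisenberg group,
`ρ(x, ξ; τ) g (y) = e^{2πiτ} e^{-iπ x·ξ} e^{2πi ξ·y} g (y - x)` with `z = (x, ξ)`. -/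
def schrodingerFun (z : EuclideanSpace ℝ (ι ⊕ ι)) (τ : ℝ) (g : EuclideanSpace ℝ ι → ℂ)
    (y : EuclideanSpace ℝ ι) : ℂ :=
  Complex.exp (2 * Real.pi * Complex.I * τ)
    * Complex.exp (-(Complex.I * Real.pi * (inner ℝ (fstHalf z) (sndHalf z) : ℝ)))
    * Complex.exp (2 * Real.pi * Complex.I * (inner ℝ (sndHalf z) y : ℝ))
    * g (y - fstHalf z)

theorem memLp_schrodingerFun (z : EuclideanSpace ℝ (ι ⊕ ι)) (τ : ℝ) (g : L2 ι) :
    MemLp (schrodingerFun z τ g) 2 volume := by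
  have h : MemLp (fun y => g (y - fstHalf z)) 2 volume :=
    (Lp.memLp g).comp_measurePreserving (measurePreserving_sub_right volume (fstHalf z))
  refine h.congr_norm ?_ (Filter.Eventually.of_forall fun y => ?_)
  · unfold schrodingerFun
    exact AEStronglyMeasurable.mul (Continuous.aestronglyMeasurable (by fun_prop)) h.1
  · simp [schrodingerFun, Complex.norm_exp]

/-- The operator `ρ(z; τ)` on `L²`. -/
def schrodinger (z : EuclideanSpace ℝ (ι ⊕ ι)) (τ : ℝ) (g : L2 ι) : L2 ι :=
  (memLp_schrodingerFun z τ g).toLp _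

/-- `T` is a metaplectic operator with projection the symplectic matrix `S`: it is unitary on
`L²` and `T ρ(z; τ) T⁻¹ = ρ(S z; τ)` for all `z` and `τ`. For each `S` this fixes `T` up to a
phase factor; both elements of the metaplectic group lying above `S` are of this kind. -/
def IsMetaplectic [DecidableEq ι] (T : L2 ι ≃ₗᵢ[ℂ] L2 ι)
    (S : Matrix.symplecticGroup ι ℝ) : Prop :=
  ∀ (z : EuclideanSpace ℝ (ι ⊕ ι)) (τ : ℝ) (g : L2 ι),
    T (schrodinger z τ (T.symm g)) =
      schrodinger (WithLp.toLp 2 ((S : Matrix (ι ⊕ ι) (ι ⊕ ι) ℝ) *ᵥ z.ofLp)) τ g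

/-- The cross metaplectic Wigner distribution `W(f, g) = Â (f ⊗ ḡ)` of an operator `Â` on
`L²(ℝ^{2n})`. -/
def crossWigner (T : L2 (ι ⊕ ι) ≃ₗᵢ[ℂ] L2 (ι ⊕ ι)) (f g : L2 ι) : L2 (ι ⊕ ι) :=
  T (tensorConj f g)

/-- `W f = W(f, f)`. -/
def wigner (T : L2 (ι ⊕ ι) ≃ₗᵢ[ℂ] L2 (ι ⊕ ι)) (f : L2 ι) : L2 (ι ⊕ ι) :=
  crossWigner T f f

/-- The weight `v_s(x) = (1 + |x|²)^{s/2}`. -/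
def weight (s : ℝ) (x : EuclideanSpace ℝ ι) : ℝ := (1 + ‖x‖ ^ 2) ^ (s / 2)

/-- `F ∈ L²_{v_s}(ℝ^ι)`: `F` is measurable and `∫ |F|² v_s² < ∞`. -/
def MemWeightedL2 (s : ℝ) (F : EuclideanSpace ℝ ι → ℂ) : Prop :=
  AEStronglyMeasurable F volume ∧
    ∫⁻ x, ENNReal.ofReal (‖F x‖ ^ 2 * weight s x ^ 2) < ∞

/-- `F ∈ L²_{v_s}(Γ)`: `χ_Γ F ∈ L²_{v_s}(ℝ^ι)`. -/
def MemWeightedL2On (s : ℝ) (Γ : Set (EuclideanSpace ℝ ι)) (F : EuclideanSpace ℝ ι → ℂ) : Prop :=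
  MemWeightedL2 s (Γ.indicator F)

/-- An open cone in `ℝ^ι ∖ {0}`: open, without the origin, invariant under positive dilations. -/
structure IsOpenCone (Γ : Set (EuclideanSpace ℝ ι)) : Prop where
  isOpen : IsOpen Γ
  zero_notMem : (0 : EuclideanSpace ℝ ι) ∉ Γ
  smul_mem : ∀ ⦃t : ℝ⦄, 0 < t → ∀ ⦃x⦄, x ∈ Γ → t • x ∈ Γ

/-- The wave front set of order `s` of `f`, a subset of `ℝ^{2n} ∖ {0}`: a nonzero `X₀` is outside
it iff `W f ∈ L²_{v_s}(Γ)` for some open cone `Γ` containing `X₀`. -/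
def waveFrontSet (T : L2 (ι ⊕ ι) ≃ₗᵢ[ℂ] L2 (ι ⊕ ι)) (s : ℝ) (f : L2 ι) :
    Set (EuclideanSpace ℝ (ι ⊕ ι)) :=
  {X₀ | X₀ ≠ 0 ∧ ¬ ∃ Γ : Set (EuclideanSpace ℝ (ι ⊕ ι)),
    IsOpenCone Γ ∧ X₀ ∈ Γ ∧ MemWeightedL2On s Γ (wigner T f)}

end AWigner

end

/-!
For an a.e. strongly measurable `F` on `ℝ^ι`, weighted square integrability is a local property in
the directions of `ℝ^ι ∖ {0}` (`AWigner.memWeightedL2_iff_forall_exists_isOpenCone`); the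
theorem is the case `F = W f`, which is measurable as an element of `L²`. If every
direction has an open conic neighbourhood on which `F` is weighted square integrable, then finitely
many of these cones cover the compact unit sphere, hence by homogeneity all of `ℝ^ι ∖ {0}`, and the
integrals over them add up to a finite bound. The origin contributes a finite amount, which is zero
unless the space is a point. Conversely `ℝ^ι ∖ {0}` is itself an open cone.
-/

namespace AWigner

variable {ι : Type*} [Fintype ι]

theorem isOpenCone_compl_singleton_zero :
    IsOpenCone ({0}ᶜ : Set (EuclideanSpace ℝ ι)) where
  isOpen := isOpen_compl_singleton
  zero_notMem := by simp
  smul_mem t ht x hx := by simpa [ht.ne'] using hx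

/-- The weighted integral of `χ_Γ F` is the weighted integral of `F` over `Γ`. -/
theorem lintegral_indicator_weight (s : ℝ) {Γ : Set (EuclideanSpace ℝ ι)} (hΓ : MeasurableSet Γ)
    (F : EuclideanSpace ℝ ι → ℂ) :
    ∫⁻ x, ENNReal.ofReal (‖Γ.indicator F x‖ ^ 2 * weight s x ^ 2) =
      ∫⁻ x in Γ, ENNReal.ofReal (‖F x‖ ^ 2 * weight s x ^ 2) := by
  rw [← lintegral_indicator hΓ]
  refine lintegral_congr fun x => ?_
  by_cases hx : x ∈ Γ <;> simp [hx]

theorem MemWeightedL2.memWeightedL2On {s : ℝ} {F : EuclideanSpace ℝ ι → ℂ}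
    (h : MemWeightedL2 s F) {Γ : Set (EuclideanSpace ℝ ι)} (hΓ : MeasurableSet Γ) :
    MemWeightedL2On s Γ F := by
  refine ⟨h.1.indicator hΓ, ?_⟩
  rw [lintegral_indicator_weight s hΓ]
  exact (setLIntegral_le_lintegral _ _).trans_lt h.2

/-- A family of open cones through all nonzero points has a finite subfamily covering the
complement of the origin. -/
theorem exists_finset_compl_singleton_zero_subset_iUnion
    {U : EuclideanSpace ℝ ι → Set (EuclideanSpace ℝ ι)}
    (hU : ∀ x, x ≠ 0 → IsOpenCone (U x) ∧ x ∈ U x) :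
    ∃ t : Finset (EuclideanSpace ℝ ι), (∀ x ∈ t, x ≠ 0) ∧ ({0}ᶜ : Set _) ⊆ ⋃ x ∈ t, U x := by
  have hne : ∀ x ∈ Metric.sphere (0 : EuclideanSpace ℝ ι) 1, x ≠ 0 := fun x hx =>
    ne_zero_of_mem_unit_sphere ⟨x, hx⟩
  obtain ⟨t, ht, hcov⟩ := (isCompact_sphere (0 : EuclideanSpace ℝ ι) 1).elim_nhds_subcover U
    fun x hx => (hU x (hne x hx)).1.isOpen.mem_nhds (hU x (hne x hx)).2
  refine ⟨t, fun x hx => hne x (ht x hx), fun y hy => ?_⟩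
  have hy0 : 0 < ‖y‖ := norm_pos_iff.2 hy
  have hmem : ‖y‖⁻¹ • y ∈ ⋃ x ∈ t, U x := hcov <| by
    simp [norm_smul, hy0.ne']
  simp only [Set.mem_iUnion] at hmem ⊢
  obtain ⟨x, hx, hyx⟩ := hmem
  refine ⟨x, hx, ?_⟩
  simpa [smul_smul, hy0.ne'] using (hU x (hne x (ht x hx))).1.smul_mem hy0 hyx

theorem memWeightedL2_iff_forall_exists_isOpenCone {s : ℝ} {F : EuclideanSpace ℝ ι → ℂ}
    (hF : AEStronglyMeasurable F volume) :
    MemWeightedL2 s F ↔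
      ∀ x, x ≠ 0 → ∃ Γ, IsOpenCone Γ ∧ x ∈ Γ ∧ MemWeightedL2On s Γ F := by
  refine ⟨fun h x hx => ⟨{0}ᶜ, isOpenCone_compl_singleton_zero, hx,
    h.memWeightedL2On (measurableSet_singleton 0).compl⟩, fun h => ⟨hF, ?_⟩⟩
  choose! U hU hxU hFU using h
  obtain ⟨t, ht, hcov⟩ :=
    exists_finset_compl_singleton_zero_subset_iUnion fun x hx => ⟨hU x hx, hxU x hx⟩
  rw [← lintegral_add_compl _ (measurableSet_singleton (0 : EuclideanSpace ℝ ι))]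
  refine ENNReal.add_lt_top.2 ⟨?_, ?_⟩
  · -- In dimension zero the origin has positive, but still finite, measure.
    rw [lintegral_singleton]
    exact ENNReal.mul_lt_top ENNReal.ofReal_lt_top measure_singleton_lt_top
  · calc ∫⁻ x in {0}ᶜ, ENNReal.ofReal (‖F x‖ ^ 2 * weight s x ^ 2)
        ≤ ∫⁻ x in ⋃ y ∈ t, U y, ENNReal.ofReal (‖F x‖ ^ 2 * weight s x ^ 2) :=
          lintegral_mono_set hcov
      _ ≤ ∑ y ∈ t, ∫⁻ x in U y, ENNReal.ofReal (‖F x‖ ^ 2 * weight s x ^ 2) := by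
          rw [← Finset.sum_coe_sort, ← tsum_fintype (L := .unconditional _),
            show ⋃ y ∈ t, U y = ⋃ y : t, U y from Set.biUnion_eq_iUnion (↑t) fun y _ => U y]
          exact lintegral_iUnion_le (fun y : t => U y) _
      _ < ∞ := ENNReal.sum_lt_top.2 fun y hy => by
          rw [← lintegral_indicator_weight s (hU y (ht y hy)).isOpen.measurableSet]
          exact (hFU y (ht y hy)).2

end AWigner

theorem proposition4p5 (n : ℕ) (f : AWigner.L2 (Fin n))
    (A : Matrix.symplecticGroup (Fin n ⊕ Fin n) ℝ)
    (Ahat : AWigner.L2 (Fin n ⊕ Fin n) ≃ₗᵢ[ℂ] AWigner.L2 (Fin n ⊕ Fin n))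
    (hA : AWigner.IsMetaplectic Ahat A) (s : ℝ) (hs : 0 ≤ s) :
    AWigner.waveFrontSet Ahat s f = ∅ ↔ AWigner.MemWeightedL2 s (AWigner.wigner Ahat f) := by
  rw [AWigner.memWeightedL2_iff_forall_exists_isOpenCone (Lp.aestronglyMeasurable _),
    Set.eq_empty_iff_forall_notMem]
  simp only [AWigner.waveFrontSet, Set.mem_ofPred_eq, not_and, not_not]
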